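/- **Theorem (Consistent Invariant Variable Selection for the Adaptive Transfer Lasso).** Fix $p\in\mathbb N$, $\beta^*\in\mathbb R^p$, and let $S=\{j:\beta^*_j\neq 0\}$. For each $n$ let $y = X\beta^*+\varepsilon$, where $X\in\mathbb R^{n\times p}$ is a fixed design with rows $x_1^\top,\dots,x_n^\top$ and $\varepsilon_1,\dots,\varepsilon_n$ are i.i.d. $\mathcal N(0,\sigma^2)$. Assume that, as $n\to\infty$, $$\tfrac1n X^\top X\to C\succ O,\qquad \tfrac1n\max_{i}\|x_i\|_2^2\to 0 .$$ Let $m=m(n)$ be nonnegative integers, positive for all large $n$, with $n/m\to r_0$ for some finite $r_0\ge 0$. Let $\tilde\beta=\tilde\beta_n$ be a random vector in $\mathbb R^p$, independent of $\varepsilon$, such that $\sqrt m\,(\tilde\beta-\beta^*)$ converges in distribution to some probability law on $\mathbb R^p$. Let $\gamma_1,\gamma_2\ge 0$ and $\lambda_n,\eta_n\ge 0$, and let $\hat\beta=\hat\beta_n$ be an Adaptive Transfer Lasso estimator, that is, a minimizer over $\beta\in\mathbb R^p$ of $$\frac1n\|y-X\beta\|_2^2+\frac{\lambda_n}{n}\sum_{j=1}^p\frac{|\beta_j|}{|\tilde\beta_j|^{\gamma_1}}+\frac{\eta_n}{n}\sum_{j=1}^p|\tilde\beta_j|^{\gamma_2}\,|\beta_j-\tilde\beta_j|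 ,$$ with the conventions $0^0=1$, $1/0=\infty$ and $\infty\cdot 0=0\cdot\infty=0$ in the weights. Suppose that one of the following regimes holds as $n\to\infty$: * (i) $\eta_n/\sqrt{n\,m^{\gamma_2}}\to\infty$ and $\sqrt{m^{\gamma_1+\gamma_2}}\,\lambda_n/\eta_n\to 0$ (equivalently, $\eta_n/(\sqrt{m^{\gamma_1+\gamma_2}}\,\lambda_n)\to\infty$, read as $\infty$ where $\lambda_n=0$); * (ii) $\sqrt{m^{\gamma_1}/n}\;\lambda_n\to\infty$, $\eta_n/\sqrt n\to\infty$, $\eta_n/\lambda_n\to\infty$ and $\eta_n/(\sqrt{m^{\gamma_1+\gamma_2}}\,\lambda_n)\to 0$; * (iv) $\sqrt{m^{\gamma_1}/n}\;\lambda_n\to\lambda_1$ for some finite $\lambda_1\ge 0$, $\eta_n/\sqrt n\to\infty$, and $\eta_n/\sqrt{n\,m^{\gamma_2}}\to\eta_1$ for some finite $\eta_1\ge 0$. Then the active coordinates coincide with those of the initial estimator with probability tending to one: $$P\big(\hat\beta_j=\tilde\beta_j\ \text{for all } j\in S\big)\longrightarrow 1 .$$ -/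

import Mathlib

open Filter Topology MeasureTheory ProbabilityTheory
open scoped ENNReal NNReal Matrix

namespace AdaptiveTransferLasso

/-- The Adaptive Transfer Lasso objective
`(1/n) ‖y - X b‖₂² + (λ/n) ∑ⱼ vⱼ |bⱼ| + (η/n) ∑ⱼ wⱼ |bⱼ - b̃ⱼ|`, where `vⱼ = 1 / |b̃ⱼ| ^ γ₁` and
`wⱼ = |b̃ⱼ| ^ γ₂`. It takes values in `[0, ∞]`, so that `vⱼ = ∞` if `b̃ⱼ = 0` and `γ₁ > 0`; with
`∞ * 0 = 0`, such a weight forces `bⱼ = 0` when `λ > 0`. -/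
noncomputable def objective {n p : ℕ} (X : Matrix (Fin n) (Fin p) ℝ) (y : Fin n → ℝ)
    (lam eta γ₁ γ₂ : ℝ) (btilde b : Fin p → ℝ) : ℝ≥0∞ :=
  ENNReal.ofReal (1 / n * ∑ i, (y i - (X *ᵥ b) i) ^ 2)
    + ENNReal.ofReal (lam / n)
        * ∑ j, (1 / ENNReal.ofReal |btilde j| ^ γ₁) * ENNReal.ofReal |b j|
    + ENNReal.ofReal (eta / n)
        * ∑ j, ENNReal.ofReal |btilde j| ^ γ₂ * ENNReal.ofReal |b j - btilde j|

/-- `b` is an Adaptive Transfer Lasso estimate: a global minimizer of the objective. -/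
def IsEstimate {n p : ℕ} (X : Matrix (Fin n) (Fin p) ℝ) (y : Fin n → ℝ)
    (lam eta γ₁ γ₂ : ℝ) (btilde b : Fin p → ℝ) : Prop :=
  ∀ b' : Fin p → ℝ,
    objective X y lam eta γ₁ γ₂ btilde b ≤ objective X y lam eta γ₁ γ₂ btilde b'

/-- Regime (i): `η / √(n m^γ₂) → ∞` and `√(m^(γ₁+γ₂)) λ / η → 0`
(the second condition allows `λ = 0`). -/
def RegimeI (m : ℕ → ℕ) (lam eta : ℕ → ℝ) (γ₁ γ₂ : ℝ) : Prop :=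
  Tendsto (fun n : ℕ => eta n / √(n * (m n : ℝ) ^ γ₂)) atTop atTop ∧
  Tendsto (fun n : ℕ => √((m n : ℝ) ^ (γ₁ + γ₂)) * lam n / eta n) atTop (𝓝 0)

/-- Regime (ii): `√(m^γ₁ / n) λ → ∞`, `η / √n → ∞`, `η / λ → ∞` and
`η / (√(m^(γ₁+γ₂)) λ) → 0`. -/
def RegimeII (m : ℕ → ℕ) (lam eta : ℕ → ℝ) (γ₁ γ₂ : ℝ) : Prop :=
  Tendsto (fun n : ℕ => √((m n : ℝ) ^ γ₁ / n) * lam n) atTop atTop ∧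
  Tendsto (fun n : ℕ => eta n / √n) atTop atTop ∧
  Tendsto (fun n : ℕ => eta n / lam n) atTop atTop ∧
  Tendsto (fun n : ℕ => eta n / (√((m n : ℝ) ^ (γ₁ + γ₂)) * lam n)) atTop (𝓝 0)

/-- Regime (iv): `√(m^γ₁ / n) λ → λ₁ ≥ 0`, `η / √n → ∞` and `η / √(n m^γ₂) → η₁ ≥ 0`. -/
def RegimeIV (m : ℕ → ℕ) (lam eta : ℕ → ℝ) (γ₁ γ₂ : ℝ) : Prop :=
  (∃ lam₁ : ℝ, 0 ≤ lam₁ ∧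
    Tendsto (fun n : ℕ => √((m n : ℝ) ^ γ₁ / n) * lam n) atTop (𝓝 lam₁)) ∧
  Tendsto (fun n : ℕ => eta n / √n) atTop atTop ∧
  (∃ eta₁ : ℝ, 0 ≤ eta₁ ∧
    Tendsto (fun n : ℕ => eta n / √(n * (m n : ℝ) ^ γ₂)) atTop (𝓝 eta₁))

end AdaptiveTransferLasso

/-!
Comparing the criterion at `β̂` and at `β*` and using that the Gram matrix is eventually uniformly
positive definite gives a quadratic inequality for `(n / η) ‖β̂ - β*‖` all of whose other
coefficients are `o(1)`, so that `β̂ - β* = o(η / n)`. If an active coordinate of `β̂` differed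
from that of `β̃`, moving it to `β̃ⱼ` would, per unit of distance moved, save the transfer penalty
`η |β̃ⱼ|^γ₂`, which is of exact order `η`, while the lasso penalty and the squared error would
grow by `o(η)` only: this contradicts minimality. All hypotheses are limits, and convergence in
probability is convergence along a filter on `ℕ × Ω`, so the argument is carried out once, without
probability, along an arbitrary filter.
-/

namespace AdaptiveTransferLasso

section ResidualSumOfSquares

variable {ι κ : Type*} [Fintype ι] [Fintype κ]

/-- The residual sum of squares `‖y - X b‖₂²`. -/
def rss (X : Matrix ι κ ℝ) (y : ι → ℝ) (b : κ → ℝ) : ℝ :=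
  ∑ i, (y i - (X *ᵥ b) i) ^ 2

lemma rss_nonneg (X : Matrix ι κ ℝ) (y : ι → ℝ) (b : κ → ℝ) : 0 ≤ rss X y b :=
  Finset.sum_nonneg fun _ _ => sq_nonneg _

lemma rss_add (X : Matrix ι κ ℝ) (y : ι → ℝ) (b d : κ → ℝ) :
    rss X y (b + d) =
      rss X y b - 2 * (d ⬝ᵥ (Xᵀ *ᵥ (y - X *ᵥ b))) + d ⬝ᵥ ((Xᵀ * X) *ᵥ d) := by
  rw [← Matrix.mulVec_mulVec, Matrix.dotProduct_mulVec, Matrix.dotProduct_mulVec,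
    Matrix.vecMul_transpose]
  simp only [rss, dotProduct, Matrix.mulVec_add, Pi.add_apply, Pi.sub_apply, Finset.mul_sum,
    ← Finset.sum_sub_distrib, ← Finset.sum_add_distrib]
  exact Finset.sum_congr rfl fun i _ => by ring

end ResidualSumOfSquares

section Criterion

/-- The penalty `λ |x|^(-γ₁) |t| + η |x|^γ₂ |t - x|` of a coordinate with value `t` and initial
estimate `x`. At `x = 0` and `γ₁ > 0` the lasso weight is `0 ^ (-γ₁) = 0` instead of the `∞` of
`objective`. -/
noncomputable def penalty (lam eta γ₁ γ₂ x t : ℝ) : ℝ :=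
  lam * (|x| ^ (-γ₁) * |t|) + eta * (|x| ^ γ₂ * |t - x|)

/-- The penalty of a coordinate with the conventions of `objective`, so with values in `[0, ∞]`. -/
noncomputable def extPenalty (lam eta γ₁ γ₂ x t : ℝ) : ℝ≥0∞ :=
  ENNReal.ofReal lam * ((1 / ENNReal.ofReal |x| ^ γ₁) * ENNReal.ofReal |t|)
    + ENNReal.ofReal eta * (ENNReal.ofReal |x| ^ γ₂ * ENNReal.ofReal |t - x|)

/-- The objective with real values, multiplied by the sample size. It agrees with `objective`
wherever the latter is finite. -/
noncomputable def criterion {n p : ℕ} (X : Matrix (Fin n) (Fin p) ℝ) (y : Fin n → ℝ)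
    (lam eta γ₁ γ₂ : ℝ) (bt b : Fin p → ℝ) : ℝ :=
  rss X y b + ∑ j, penalty lam eta γ₁ γ₂ (bt j) (b j)

section

variable {lam eta γ₁ γ₂ x s t : ℝ}

lemma penalty_nonneg (hlam : 0 ≤ lam) (heta : 0 ≤ eta) : 0 ≤ penalty lam eta γ₁ γ₂ x t := by
  unfold penalty
  positivity

lemma penalty_sub_penalty_le (heta : 0 ≤ eta) :
    penalty lam eta γ₁ γ₂ x s - penalty lam eta γ₁ γ₂ x t ≤
      lam * (|x| ^ (-γ₁) * (|s| - |t|)) + eta * (|x| ^ γ₂ * |s - x|) := by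
  have : 0 ≤ eta * (|x| ^ γ₂ * |t - x|) := by positivity
  unfold penalty
  linarith

lemma one_div_ofReal_abs_rpow_eq_or_eq_top (γ x : ℝ) :
    1 / ENNReal.ofReal |x| ^ γ = ENNReal.ofReal (|x| ^ (-γ)) ∨
      1 / ENNReal.ofReal |x| ^ γ = ∞ := by
  rw [one_div, ← ENNReal.rpow_neg]
  rcases eq_or_ne x 0 with rfl | hx
  · rcases lt_trichotomy (-γ) 0 with hγ | hγ | hγ
    · right; simp [hγ]
    · left; simp [hγ]
    · left; simp [hγ, Real.zero_rpow hγ.ne']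
  · exact .inl (ENNReal.ofReal_rpow_of_pos (abs_pos.mpr hx))

lemma extPenalty_eq_ofReal_or_eq_top (hlam : 0 ≤ lam) (heta : 0 ≤ eta) (hγ₂ : 0 ≤ γ₂) :
    extPenalty lam eta γ₁ γ₂ x t = ENNReal.ofReal (penalty lam eta γ₁ γ₂ x t) ∨
      extPenalty lam eta γ₁ γ₂ x t = ∞ := by
  have htransfer : ENNReal.ofReal eta * (ENNReal.ofReal |x| ^ γ₂ * ENNReal.ofReal |t - x|) =
      ENNReal.ofReal (eta * (|x| ^ γ₂ * |t - x|)) := by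
    rw [ENNReal.ofReal_rpow_of_nonneg (abs_nonneg x) hγ₂, ENNReal.ofReal_mul heta,
      ENNReal.ofReal_mul (by positivity)]
  rw [extPenalty, penalty, ENNReal.ofReal_add (by positivity) (by positivity), htransfer,
    ENNReal.ofReal_mul hlam, ENNReal.ofReal_mul (p := |x| ^ (-γ₁)) (by positivity)]
  rcases one_div_ofReal_abs_rpow_eq_or_eq_top γ₁ x with hweight | hweight
  · exact .inl (by rw [hweight])
  rcases hlam.eq_or_lt with rfl | hlam
  · left; simp
  rcases eq_or_ne t 0 with rfl | ht
  · left; simp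
  · right; simp [hweight, hlam, ht]

lemma ofReal_penalty_le_extPenalty (hlam : 0 ≤ lam) (heta : 0 ≤ eta) (hγ₂ : 0 ≤ γ₂) :
    ENNReal.ofReal (penalty lam eta γ₁ γ₂ x t) ≤ extPenalty lam eta γ₁ γ₂ x t := by
  rcases extPenalty_eq_ofReal_or_eq_top (γ₁ := γ₁) (x := x) (t := t) hlam heta hγ₂ with h | h
  · exact h.ge
  · exact h ▸ le_top

lemma extPenalty_ne_top (hγ₂ : 0 ≤ γ₂) (h : t = 0 ∨ x ≠ 0) :
    extPenalty lam eta γ₁ γ₂ x t ≠ ∞ := by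
  have htransfer : ENNReal.ofReal |x| ^ γ₂ ≠ ∞ :=
    ENNReal.rpow_ne_top_of_nonneg hγ₂ ENNReal.ofReal_ne_top
  refine ENNReal.add_ne_top.mpr ⟨?_, by finiteness⟩
  rcases h with rfl | hx
  · simp
  · have hweight : ENNReal.ofReal |x| ^ γ₁ ≠ 0 :=
      (ENNReal.rpow_pos (by simpa using hx) ENNReal.ofReal_ne_top).ne'
    rw [one_div]
    finiteness

end

variable {n p : ℕ} {X : Matrix (Fin n) (Fin p) ℝ} {y : Fin n → ℝ} {lam eta γ₁ γ₂ : ℝ}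
  {bt b b₀ : Fin p → ℝ}

lemma objective_eq_ofReal_rss_add_sum_extPenalty :
    objective X y lam eta γ₁ γ₂ bt b =
      ENNReal.ofReal (1 / n * rss X y b)
        + ∑ j, extPenalty (lam / n) (eta / n) γ₁ γ₂ (bt j) (b j) := by
  simp only [objective, rss, extPenalty, Finset.mul_sum, Finset.sum_add_distrib, add_assoc]

lemma objective_ne_top_iff :
    objective X y lam eta γ₁ γ₂ bt b ≠ ∞ ↔
      ∀ j, extPenalty (lam / n) (eta / n) γ₁ γ₂ (bt j) (b j) ≠ ∞ := by
  rw [objective_eq_ofReal_rss_add_sum_extPenalty, ENNReal.add_ne_top,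
    and_iff_right ENNReal.ofReal_ne_top]
  simp [ENNReal.sum_eq_top]

lemma one_div_mul_criterion :
    1 / n * criterion X y lam eta γ₁ γ₂ bt b =
      1 / n * rss X y b + ∑ j, penalty (lam / n) (eta / n) γ₁ γ₂ (bt j) (b j) := by
  rw [criterion, mul_add, Finset.mul_sum]
  congr 1
  exact Finset.sum_congr rfl fun j _ => by unfold penalty; ring

lemma criterion_nonneg (hlam : 0 ≤ lam) (heta : 0 ≤ eta) :
    0 ≤ criterion X y lam eta γ₁ γ₂ bt b :=
  add_nonneg (rss_nonneg X y b) (Finset.sum_nonneg fun _ _ => penalty_nonneg hlam heta)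

lemma ofReal_criterion (hlam : 0 ≤ lam) (heta : 0 ≤ eta) :
    ENNReal.ofReal (1 / n * criterion X y lam eta γ₁ γ₂ bt b) =
      ENNReal.ofReal (1 / n * rss X y b)
        + ∑ j, ENNReal.ofReal (penalty (lam / n) (eta / n) γ₁ γ₂ (bt j) (b j)) := by
  have hpen : ∀ j, 0 ≤ penalty (lam / n) (eta / n) γ₁ γ₂ (bt j) (b j) := fun _ =>
    penalty_nonneg (by positivity) (by positivity)
  have hrss : 0 ≤ 1 / n * rss X y b := mul_nonneg (by positivity) (rss_nonneg X y b)
  rw [one_div_mul_criterion, ENNReal.ofReal_add hrss (Finset.sum_nonneg fun j _ => hpen j),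
    ENNReal.ofReal_sum_of_nonneg fun j _ => hpen j]

lemma ofReal_criterion_le_objective (hlam : 0 ≤ lam) (heta : 0 ≤ eta) (hγ₂ : 0 ≤ γ₂) :
    ENNReal.ofReal (1 / n * criterion X y lam eta γ₁ γ₂ bt b) ≤
      objective X y lam eta γ₁ γ₂ bt b := by
  rw [ofReal_criterion hlam heta, objective_eq_ofReal_rss_add_sum_extPenalty]
  gcongr
  exact ofReal_penalty_le_extPenalty (by positivity) (by positivity) hγ₂

lemma objective_eq_ofReal_criterion (hlam : 0 ≤ lam) (heta : 0 ≤ eta) (hγ₂ : 0 ≤ γ₂)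
    (h : objective X y lam eta γ₁ γ₂ bt b ≠ ∞) :
    objective X y lam eta γ₁ γ₂ bt b =
      ENNReal.ofReal (1 / n * criterion X y lam eta γ₁ γ₂ bt b) := by
  rw [ofReal_criterion hlam heta, objective_eq_ofReal_rss_add_sum_extPenalty]
  congr 1
  exact Finset.sum_congr rfl fun j _ => (extPenalty_eq_ofReal_or_eq_top (by positivity)
    (by positivity) hγ₂).resolve_right (objective_ne_top_iff.mp h j)

lemma IsEstimate.objective_ne_top (hb : IsEstimate X y lam eta γ₁ γ₂ bt b) (hγ₂ : 0 ≤ γ₂) :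
    objective X y lam eta γ₁ γ₂ bt b ≠ ∞ :=
  ne_top_of_le_ne_top
    (objective_ne_top_iff.mpr fun j => extPenalty_ne_top hγ₂ (eq_or_ne (bt j) 0)) (hb bt)

lemma IsEstimate.criterion_le (hb : IsEstimate X y lam eta γ₁ γ₂ bt b) (hn : n ≠ 0)
    (hlam : 0 ≤ lam) (heta : 0 ≤ eta) (hγ₂ : 0 ≤ γ₂)
    (hb₀ : ∀ j, b₀ j = b j ∨ b₀ j = 0 ∨ bt j ≠ 0) :
    criterion X y lam eta γ₁ γ₂ bt b ≤ criterion X y lam eta γ₁ γ₂ bt b₀ := by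
  have hfin : objective X y lam eta γ₁ γ₂ bt b₀ ≠ ∞ := objective_ne_top_iff.mpr fun j => by
    rcases hb₀ j with h | h
    · exact h ▸ objective_ne_top_iff.mp (hb.objective_ne_top hγ₂) j
    · exact extPenalty_ne_top hγ₂ h
  have hle := (ofReal_criterion_le_objective hlam heta hγ₂).trans (hb b₀)
  rw [objective_eq_ofReal_criterion hlam heta hγ₂ hfin, ENNReal.ofReal_le_ofReal_iff
    (mul_nonneg (by positivity) (criterion_nonneg hlam heta))] at hle
  exact le_of_mul_le_mul_left hle (by positivity)

end Criterion

section QuadraticForm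

variable {κ : Type*} [Fintype κ]

lemma dotProduct_le_card_mul_norm_mul_norm (u v : κ → ℝ) :
    u ⬝ᵥ v ≤ Fintype.card κ * (‖u‖ * ‖v‖) :=
  calc u ⬝ᵥ v ≤ ∑ _j : κ, ‖u‖ * ‖v‖ := Finset.sum_le_sum fun j _ =>
        (le_abs_self _).trans ((norm_mul_le (u j) (v j)).trans
          (mul_le_mul (norm_le_pi_norm u j) (norm_le_pi_norm v j) (norm_nonneg _) (norm_nonneg _)))
    _ = Fintype.card κ * (‖u‖ * ‖v‖) := by simp

lemma exists_pos_eventually_mul_sq_norm_le {C : Matrix κ κ ℝ} (hC : C.PosDef) :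
    ∃ c : ℝ, 0 < c ∧ ∀ᶠ D in 𝓝 C, ∀ u : κ → ℝ, c * ‖u‖ ^ 2 ≤ u ⬝ᵥ (D *ᵥ u) := by
  let Q (D : Matrix κ κ ℝ) (u : κ → ℝ) : ℝ := u ⬝ᵥ (D *ᵥ u)
  have hQ : Continuous fun q : Matrix κ κ ℝ × (κ → ℝ) => Q q.1 q.2 := by fun_prop
  have hsphere : ∃ c : ℝ, 0 < c ∧ ∀ u ∈ Metric.sphere (0 : κ → ℝ) 1, c < Q C u := by
    have hpos : ∀ u ∈ Metric.sphere (0 : κ → ℝ) 1, 0 < Q C u := fun u hu => by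
      simpa using hC.dotProduct_mulVec_pos (ne_zero_of_mem_unit_sphere ⟨u, hu⟩)
    obtain ⟨c, hc, hlt⟩ := (isCompact_sphere (0 : κ → ℝ) 1).exists_forall_le' (f := Q C)
      (by fun_prop) hpos
    exact ⟨c / 2, half_pos hc, fun u hu => (half_lt_self hc).trans_le (hlt u hu)⟩
  obtain ⟨c, hc, hlt⟩ := hsphere
  have hunif : ∀ᶠ D in 𝓝 C, ∀ u ∈ Metric.sphere (0 : κ → ℝ) 1, c < Q D u :=
    (isCompact_sphere 0 1).eventually_forall_of_forall_eventually fun u hu =>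
      hQ.continuousAt.eventually_const_lt (hlt u hu)
  refine ⟨c, hc, hunif.mono fun D hD u => ?_⟩
  rcases eq_or_ne u 0 with rfl | hu
  · simp
  have hu' : 0 < ‖u‖ := norm_pos_iff.mpr hu
  have hunit := hD (‖u‖⁻¹ • u) (by simp [norm_smul, hu'.ne'])
  simp only [Q, Matrix.mulVec_smul, smul_dotProduct, dotProduct_smul, smul_eq_mul] at hunit
  calc c * ‖u‖ ^ 2 ≤ (‖u‖⁻¹ * (‖u‖⁻¹ * u ⬝ᵥ (D *ᵥ u))) * ‖u‖ ^ 2 := by gcongr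
    _ = u ⬝ᵥ (D *ᵥ u) := by field_simp

end QuadraticForm

lemma tendsto_zero_of_mul_sq_le_mul_add {ι : Type*} {l : Filter ι} {c : ℝ} {s B D : ι → ℝ}
    (hc : 0 < c) (hB : Tendsto B l (𝓝 0)) (hD : Tendsto D l (𝓝 0))
    (h : ∀ᶠ i in l, c * s i ^ 2 ≤ B i * s i + D i) : Tendsto s l (𝓝 0) := by
  have hbound : Tendsto (fun i => (B i / c) ^ 2 + 2 * D i / c) l (𝓝 0) := by
    simpa using ((hB.div_const c).pow 2).add ((hD.const_mul 2).div_const c)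
  have hsq : Tendsto (fun i => s i ^ 2) l (𝓝 0) := by
    refine squeeze_zero' (.of_forall fun i => sq_nonneg _) (h.mono fun i hi => ?_) hbound
    have hyoung : 2 * (B i * s i) ≤ c * s i ^ 2 + B i ^ 2 / c := by
      have : 0 ≤ (c * s i - B i) ^ 2 / c := by positivity
      have : (c * s i - B i) ^ 2 / c = c * s i ^ 2 + B i ^ 2 / c - 2 * (B i * s i) := by
        field_simp
        ring
      linarith
    have : c * s i ^ 2 ≤ B i ^ 2 / c + 2 * D i := by linarith
    calc s i ^ 2 = c * s i ^ 2 / c := by field_simp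
      _ ≤ (B i ^ 2 / c + 2 * D i) / c := by gcongr
      _ = (B i / c) ^ 2 + 2 * D i / c := by field_simp
  exact (tendsto_zero_iff_abs_tendsto_zero s).mpr (by
    simpa [Function.comp_def, Real.sqrt_sq_eq_abs] using hsq.sqrt)

section Estimate

variable {n p : ℕ} {X : Matrix (Fin n) (Fin p) ℝ} {e : Fin n → ℝ} {y : Fin n → ℝ}
  {lam eta γ₁ γ₂ : ℝ} {β bt b : Fin p → ℝ}

lemma IsEstimate.gram_le (hb : IsEstimate X (X *ᵥ β + e) lam eta γ₁ γ₂ bt b) (hn : n ≠ 0)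
    (hlam : 0 ≤ lam) (heta : 0 ≤ eta) (hγ₂ : 0 ≤ γ₂) (hβ : ∀ j, β j ≠ 0 → bt j ≠ 0) :
    (b - β) ⬝ᵥ ((Xᵀ * X) *ᵥ (b - β)) ≤ 2 * ((b - β) ⬝ᵥ (Xᵀ *ᵥ e))
      + lam * ∑ j with β j ≠ 0, |bt j| ^ (-γ₁) * |b j - β j|
      + eta * ∑ j, |bt j| ^ γ₂ * |bt j - β j| := by
  have hcrit := hb.criterion_le hn hlam heta hγ₂ (b₀ := β) fun j =>
    .inr ((eq_or_ne (β j) 0).imp_right (hβ j))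
  have hrss := rss_add X (X *ᵥ β + e) β (b - β)
  rw [add_sub_cancel, add_sub_cancel_left] at hrss
  have hpen : ∑ j, penalty lam eta γ₁ γ₂ (bt j) (β j) - ∑ j, penalty lam eta γ₁ γ₂ (bt j) (b j) ≤
      lam * ∑ j with β j ≠ 0, |bt j| ^ (-γ₁) * |b j - β j|
        + eta * ∑ j, |bt j| ^ γ₂ * |bt j - β j| := by
    rw [← Finset.sum_sub_distrib, Finset.sum_filter, Finset.mul_sum, Finset.mul_sum,
      ← Finset.sum_add_distrib]
    refine Finset.sum_le_sum fun j _ => (penalty_sub_penalty_le heta).trans ?_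
    rw [abs_sub_comm (bt j)]
    gcongr
    split_ifs with hj
    · rw [abs_sub_comm (b j)]
      gcongr
      exact abs_sub_abs_le_abs_sub _ _
    · rw [not_not.mp hj, abs_zero, zero_sub, mul_neg]
      exact neg_nonpos.mpr (by positivity)
  unfold criterion at hcrit
  linarith

lemma IsEstimate.gram_le_norm (hb : IsEstimate X (X *ᵥ β + e) lam eta γ₁ γ₂ bt b) (hn : n ≠ 0)
    (hlam : 0 ≤ lam) (heta : 0 ≤ eta) (hγ₂ : 0 ≤ γ₂) (hβ : ∀ j, β j ≠ 0 → bt j ≠ 0) :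
    (b - β) ⬝ᵥ ((Xᵀ * X) *ᵥ (b - β)) ≤
      (2 * (p * ‖Xᵀ *ᵥ e‖) + lam * ∑ j with β j ≠ 0, |bt j| ^ (-γ₁)) * ‖b - β‖
        + eta * ((∑ j, |bt j| ^ γ₂) * ‖bt - β‖) := by
  have hscore : (b - β) ⬝ᵥ (Xᵀ *ᵥ e) ≤ p * (‖b - β‖ * ‖Xᵀ *ᵥ e‖) := by
    simpa using dotProduct_le_card_mul_norm_mul_norm (b - β) (Xᵀ *ᵥ e)
  have hlasso : ∑ j with β j ≠ 0, |bt j| ^ (-γ₁) * |b j - β j| ≤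
      (∑ j with β j ≠ 0, |bt j| ^ (-γ₁)) * ‖b - β‖ := by
    rw [Finset.sum_mul]
    gcongr with j
    exact norm_le_pi_norm (b - β) j
  have htransfer : ∑ j, |bt j| ^ γ₂ * |bt j - β j| ≤ (∑ j, |bt j| ^ γ₂) * ‖bt - β‖ := by
    rw [Finset.sum_mul]
    gcongr with j
    exact norm_le_pi_norm (bt - β) j
  linarith [hb.gram_le hn hlam heta hγ₂ hβ, mul_le_mul_of_nonneg_left hlasso hlam,
    mul_le_mul_of_nonneg_left htransfer heta]

lemma IsEstimate.eta_mul_rpow_le (hb : IsEstimate X y lam eta γ₁ γ₂ bt b) (hn : n ≠ 0)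
    (hlam : 0 ≤ lam) (heta : 0 ≤ eta) (hγ₂ : 0 ≤ γ₂) {j : Fin p} (hj : bt j ≠ 0)
    (hne : b j ≠ bt j) :
    eta * |bt j| ^ γ₂ ≤ lam * |bt j| ^ (-γ₁) + 2 * |(Xᵀ *ᵥ (y - X *ᵥ b)) j|
      + |bt j - b j| * (Xᵀ * X) j j := by
  set δ := bt j - b j with hδ
  have hδ_pos : 0 < |δ| := abs_pos.mpr (sub_ne_zero.mpr hne.symm)
  have hupdate : Function.update b j (bt j) = b + Pi.single j δ := by
    ext k
    rcases eq_or_ne k j with rfl | hk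
    · simp [hδ]
    · simp [hk]
  have hcrit := hb.criterion_le hn hlam heta hγ₂ (b₀ := Function.update b j (bt j)) fun k => by
    rcases eq_or_ne k j with rfl | hk
    · exact .inr (.inr hj)
    · exact .inl (Function.update_of_ne hk _ _)
  have hrss : rss X y (Function.update b j (bt j)) - rss X y b ≤
      |δ| * (2 * |(Xᵀ *ᵥ (y - X *ᵥ b)) j| + |δ| * (Xᵀ * X) j j) := by
    have hcross := (neg_le_abs _).trans_eq (abs_mul δ ((Xᵀ *ᵥ (y - X *ᵥ b)) j))
    rw [hupdate, rss_add, single_dotProduct, single_dotProduct, Matrix.mulVec_single]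
    simp only [Pi.smul_apply, Matrix.col_apply, MulOpposite.smul_eq_mul_unop,
      MulOpposite.unop_op]
    linear_combination 2 * hcross - (Xᵀ * X) j j * sq_abs δ
  have hpen : ∑ k, penalty lam eta γ₁ γ₂ (bt k) (Function.update b j (bt j) k)
      - ∑ k, penalty lam eta γ₁ γ₂ (bt k) (b k) ≤
      |δ| * (lam * |bt j| ^ (-γ₁) - eta * |bt j| ^ γ₂) := by
    have hsingle : ∑ k, (penalty lam eta γ₁ γ₂ (bt k) (Function.update b j (bt j) k)
        - penalty lam eta γ₁ γ₂ (bt k) (b k)) =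
        penalty lam eta γ₁ γ₂ (bt j) (bt j) - penalty lam eta γ₁ γ₂ (bt j) (b j) := by
      rw [Finset.sum_eq_single j (fun k _ hk => by rw [Function.update_of_ne hk, sub_self])
        (by simp), Function.update_self]
    have htriangle : lam * |bt j| ^ (-γ₁) * (|bt j| - |b j|) ≤ lam * |bt j| ^ (-γ₁) * |δ| := by
      gcongr
      exact abs_sub_abs_le_abs_sub _ _
    rw [← Finset.sum_sub_distrib, hsingle, penalty, penalty, sub_self, abs_zero,
      abs_sub_comm (b j)]
    linarith
  refine le_of_mul_le_mul_left ?_ hδ_pos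
  unfold criterion at hcrit
  linarith

end Estimate

section Normalized

variable {n p : ℕ} {X : Matrix (Fin n) (Fin p) ℝ} {e : Fin n → ℝ} {y : Fin n → ℝ}
  {lam eta γ₁ γ₂ : ℝ} {β bt b : Fin p → ℝ}

lemma IsEstimate.normalized_gram_le_norm
    (hb : IsEstimate X (X *ᵥ β + e) lam eta γ₁ γ₂ bt b) (hn : n ≠ 0)
    (hlam : 0 ≤ lam) (heta : 0 < eta) (hγ₂ : 0 ≤ γ₂) (hβ : ∀ j, β j ≠ 0 → bt j ≠ 0) :
    ((n / eta) • (b - β)) ⬝ᵥ (((1 / n : ℝ) • (Xᵀ * X)) *ᵥ ((n / eta) • (b - β))) ≤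
      (2 * (p * ‖eta⁻¹ • (Xᵀ *ᵥ e)‖) + lam / eta * ∑ j with β j ≠ 0, |bt j| ^ (-γ₁))
          * ‖(n / eta) • (b - β)‖
        + (∑ j, |bt j| ^ γ₂) * ‖(n / eta) • (bt - β)‖ := by
  have hn_pos : (0 : ℝ) < n := by positivity
  simp only [Matrix.smul_mulVec, Matrix.mulVec_smul, smul_dotProduct, dotProduct_smul, smul_eq_mul,
    norm_smul, norm_inv, norm_div, Real.norm_of_nonneg heta.le, Real.norm_of_nonneg hn_pos.le]
  set q := (b - β) ⬝ᵥ ((Xᵀ * X) *ᵥ (b - β))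
  calc n / eta * (1 / n * (n / eta * q)) = n / eta ^ 2 * q := by field_simp
    _ ≤ n / eta ^ 2 * ((2 * (p * ‖Xᵀ *ᵥ e‖) + lam * ∑ j with β j ≠ 0, |bt j| ^ (-γ₁)) * ‖b - β‖
        + eta * ((∑ j, |bt j| ^ γ₂) * ‖bt - β‖)) := by
      gcongr
      exact hb.gram_le_norm hn hlam heta.le hγ₂ hβ
    _ = _ := by field_simp

lemma IsEstimate.abs_rpow_le_normalized (hb : IsEstimate X y lam eta γ₁ γ₂ bt b) (hn : n ≠ 0)
    (hlam : 0 ≤ lam) (heta : 0 < eta) (hγ₂ : 0 ≤ γ₂) {j : Fin p} (hj : bt j ≠ 0)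
    (hne : b j ≠ bt j) :
    |bt j| ^ γ₂ ≤ lam / eta * |bt j| ^ (-γ₁) + 2 * ‖eta⁻¹ • (Xᵀ *ᵥ (y - X *ᵥ b))‖
      + ‖(n / eta) • (bt - b)‖ * ((1 / n : ℝ) • (Xᵀ * X)) j j := by
  have hn_pos : (0 : ℝ) < n := by positivity
  have hdiag : 0 ≤ (Xᵀ * X) j j := by
    simpa [Matrix.mul_apply] using Finset.sum_nonneg fun k _ => mul_self_nonneg (X k j)
  have hscore : |(Xᵀ *ᵥ (y - X *ᵥ b)) j| ≤ ‖Xᵀ *ᵥ (y - X *ᵥ b)‖ :=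
    norm_le_pi_norm (Xᵀ *ᵥ (y - X *ᵥ b)) j
  have hgap : |bt j - b j| ≤ ‖bt - b‖ := norm_le_pi_norm (bt - b) j
  simp only [norm_smul, norm_inv, norm_div, Real.norm_of_nonneg heta.le,
    Real.norm_of_nonneg hn_pos.le, Matrix.smul_apply, smul_eq_mul]
  calc |bt j| ^ γ₂ = eta⁻¹ * (eta * |bt j| ^ γ₂) := by field_simp
    _ ≤ eta⁻¹ * (lam * |bt j| ^ (-γ₁) + 2 * ‖Xᵀ *ᵥ (y - X *ᵥ b)‖ + ‖bt - b‖ * (Xᵀ * X) j j) := by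
      gcongr
      exact (hb.eta_mul_rpow_le hn hlam heta.le hγ₂ hj hne).trans (by gcongr)
    _ = _ := by field_simp

end Normalized

section Asymptotics

variable {ι : Type*} {l : Filter ι} {p : ℕ} {N : ι → ℕ} {X : ∀ i, Matrix (Fin (N i)) (Fin p) ℝ}
  {e : ∀ i, Fin (N i) → ℝ} {C : Matrix (Fin p) (Fin p) ℝ} {lam eta : ι → ℝ} {γ₁ γ₂ : ℝ}
  {β : Fin p → ℝ} {bt b : ι → Fin p → ℝ}

lemma tendsto_div_smul_estimate_sub (hN : ∀ᶠ i in l, N i ≠ 0) (hC : C.PosDef)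
    (hX : Tendsto (fun i => (1 / N i : ℝ) • ((X i)ᵀ * X i)) l (𝓝 C))
    (hlam : ∀ᶠ i in l, 0 ≤ lam i) (heta : ∀ᶠ i in l, 0 < eta i) (hγ₂ : 0 ≤ γ₂)
    (hlam_eta : Tendsto (fun i => lam i / eta i) l (𝓝 0))
    (hscore : Tendsto (fun i => (eta i)⁻¹ • ((X i)ᵀ *ᵥ e i)) l (𝓝 0))
    (hbt : Tendsto bt l (𝓝 β))
    (hrate : Tendsto (fun i => (N i / eta i) • (bt i - β)) l (𝓝 0))
    (hb : ∀ᶠ i in l, IsEstimate (X i) (X i *ᵥ β + e i) (lam i) (eta i) γ₁ γ₂ (bt i) (b i)) :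
    Tendsto (fun i => (N i / eta i) • (b i - β)) l (𝓝 0) := by
  have hbt_apply (j : Fin p) : Tendsto (fun i => bt i j) l (𝓝 (β j)) := tendsto_pi_nhds.mp hbt j
  have hactive : ∀ᶠ i in l, ∀ j, β j ≠ 0 → bt i j ≠ 0 := by
    simpa only [eventually_all] using fun j hj => (hbt_apply j).eventually_ne hj
  have hlasso : Tendsto (fun i => ∑ j with β j ≠ 0, |bt i j| ^ (-γ₁)) l
      (𝓝 (∑ j with β j ≠ 0, |β j| ^ (-γ₁))) :=
    tendsto_finsetSum _ fun j hj => (hbt_apply j).abs.rpow_const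
      (.inl (abs_ne_zero.mpr (Finset.mem_filter.mp hj).2))
  have htransfer : Tendsto (fun i => ∑ j, |bt i j| ^ γ₂) l (𝓝 (∑ j, |β j| ^ γ₂)) :=
    tendsto_finsetSum _ fun j _ => (hbt_apply j).abs.rpow_const (.inr hγ₂)
  have hlinear : Tendsto (fun i => 2 * (p * ‖(eta i)⁻¹ • ((X i)ᵀ *ᵥ e i)‖)
      + lam i / eta i * ∑ j with β j ≠ 0, |bt i j| ^ (-γ₁)) l (𝓝 0) := by
    simpa using ((hscore.norm.const_mul (p : ℝ)).const_mul 2).add (hlam_eta.mul hlasso)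
  have hconst : Tendsto
      (fun i => (∑ j, |bt i j| ^ γ₂) * ‖(N i / eta i : ℝ) • (bt i - β)‖) l (𝓝 0) := by
    simpa using htransfer.mul hrate.norm
  obtain ⟨c, hc, hgram⟩ := exists_pos_eventually_mul_sq_norm_le hC
  rw [tendsto_zero_iff_norm_tendsto_zero]
  refine tendsto_zero_of_mul_sq_le_mul_add hc hlinear hconst ?_
  filter_upwards [hN, hlam, heta, hb, hactive, hX.eventually hgram]
    with i hN hlam heta hb hactive hgram
  exact (hgram _).trans (hb.normalized_gram_le_norm hN hlam heta hγ₂ hactive)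

lemma tendsto_inv_smul_transpose_mulVec_residual (hN : ∀ᶠ i in l, N i ≠ 0)
    (hX : Tendsto (fun i => (1 / N i : ℝ) • ((X i)ᵀ * X i)) l (𝓝 C))
    (hscore : Tendsto (fun i => (eta i)⁻¹ • ((X i)ᵀ *ᵥ e i)) l (𝓝 0))
    (hb : Tendsto (fun i => (N i / eta i) • (b i - β)) l (𝓝 0)) :
    Tendsto (fun i => (eta i)⁻¹ • ((X i)ᵀ *ᵥ (X i *ᵥ β + e i - X i *ᵥ b i))) l (𝓝 0) := by
  have hfit : Tendsto (fun i => ((1 / N i : ℝ) • ((X i)ᵀ * X i)) *ᵥ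
      ((N i / eta i : ℝ) • (b i - β))) l (𝓝 (C *ᵥ 0)) :=
    ((continuous_fst.matrix_mulVec continuous_snd).tendsto (C, 0)).comp (hX.prodMk_nhds hb)
  rw [Matrix.mulVec_zero] at hfit
  refine (sub_zero (0 : Fin p → ℝ) ▸ hscore.sub hfit).congr' ?_
  filter_upwards [hN] with i hN
  have hscalar : 1 / (N i : ℝ) * (N i / eta i) = (eta i)⁻¹ := by field_simp
  have hresidual : X i *ᵥ β + e i - X i *ᵥ b i = e i - X i *ᵥ (b i - β) := by
    rw [Matrix.mulVec_sub]
    abel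
  rw [Matrix.smul_mulVec, Matrix.mulVec_smul, smul_smul, hscalar, ← smul_sub, hresidual,
    Matrix.mulVec_sub (X i)ᵀ, Matrix.mulVec_mulVec]

theorem eventually_forall_estimate_eq (hN : ∀ᶠ i in l, N i ≠ 0) (hC : C.PosDef)
    (hX : Tendsto (fun i => (1 / N i : ℝ) • ((X i)ᵀ * X i)) l (𝓝 C))
    (hlam : ∀ᶠ i in l, 0 ≤ lam i) (heta : ∀ᶠ i in l, 0 < eta i) (hγ₂ : 0 ≤ γ₂)
    (hlam_eta : Tendsto (fun i => lam i / eta i) l (𝓝 0))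
    (hscore : Tendsto (fun i => (eta i)⁻¹ • ((X i)ᵀ *ᵥ e i)) l (𝓝 0))
    (hbt : Tendsto bt l (𝓝 β))
    (hrate : Tendsto (fun i => (N i / eta i) • (bt i - β)) l (𝓝 0))
    (hb : ∀ᶠ i in l, IsEstimate (X i) (X i *ᵥ β + e i) (lam i) (eta i) γ₁ γ₂ (bt i) (b i)) :
    ∀ᶠ i in l, ∀ j, β j ≠ 0 → b i j = bt i j := by
  simp only [eventually_all]
  intro j hj
  have hbt_j : Tendsto (fun i => bt i j) l (𝓝 (β j)) := tendsto_pi_nhds.mp hbt j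
  have hweight (γ : ℝ) : Tendsto (fun i => |bt i j| ^ γ) l (𝓝 (|β j| ^ γ)) :=
    hbt_j.abs.rpow_const (.inl (abs_ne_zero.mpr hj))
  have hb_rate := tendsto_div_smul_estimate_sub hN hC hX hlam heta hγ₂ hlam_eta hscore hbt hrate hb
  have hresidual := tendsto_inv_smul_transpose_mulVec_residual hN hX hscore hb_rate
  have hgap : Tendsto (fun i => (N i / eta i) • (bt i - b i)) l (𝓝 0) := by
    simpa only [← smul_sub, sub_sub_sub_cancel_right, sub_zero] using hrate.sub hb_rate
  have hdiag : Tendsto (fun i => ((1 / N i : ℝ) • ((X i)ᵀ * X i)) j j) l (𝓝 (C j j)) :=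
    tendsto_pi_nhds.mp (tendsto_pi_nhds.mp hX j) j
  have hbound : Tendsto (fun i => lam i / eta i * |bt i j| ^ (-γ₁)
      + 2 * ‖(eta i)⁻¹ • ((X i)ᵀ *ᵥ (X i *ᵥ β + e i - X i *ᵥ b i))‖
      + ‖(N i / eta i) • (bt i - b i)‖ * ((1 / N i : ℝ) • ((X i)ᵀ * X i)) j j) l (𝓝 0) := by
    simpa using ((hlam_eta.mul (hweight (-γ₁))).add (hresidual.norm.const_mul 2)).add
      (hgap.norm.mul hdiag)
  filter_upwards [hbound.eventually_lt (hweight γ₂) (by positivity), hN, hlam, heta, hb,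
    hbt_j.eventually_ne hj] with i hlt hN hlam heta hb hbt_ne
  by_contra hne
  exact hlt.not_ge (hb.abs_rpow_le_normalized hN hlam heta hγ₂ hbt_ne hne)

end Asymptotics

section ConvergenceInProbability

variable {ι Ω : Type*} [MeasurableSpace Ω] {μ : Measure Ω} {l : Filter ι}

/-- The filter of events of asymptotically full measure: convergence along it of a family indexed
by `ι × Ω` is convergence in `μ`-measure along `l`, so that limit theorems for arbitrary filters
apply to convergence in probability. Events need not be measurable. -/
def inProbability (μ : Measure Ω) (l : Filter ι) : Filter (ι × Ω) where
  sets := {s | Tendsto (fun i => μ {ω | (i, ω) ∉ s}) l (𝓝 0)}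
  univ_sets := by simp [tendsto_const_nhds]
  sets_of_superset hs hst :=
    tendsto_of_tendsto_of_tendsto_of_le_of_le tendsto_const_nhds hs (fun _ => zero_le)
      fun _ => measure_mono fun _ hω => mt (@hst _) hω
  inter_sets {s t} hs ht := by
    refine tendsto_of_tendsto_of_tendsto_of_le_of_le tendsto_const_nhds
      (by simpa using Tendsto.add hs ht) (fun _ => zero_le) fun i => ?_
    refine (measure_mono fun ω hω => ?_).trans (measure_union_le _ _)
    exact not_and_or.mp hω

lemma eventually_inProbability {P : ι × Ω → Prop} :
    (∀ᶠ q in inProbability μ l, P q) ↔ Tendsto (fun i => μ {ω | ¬ P (i, ω)}) l (𝓝 0) :=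
  Iff.rfl

lemma tendsto_fst_inProbability : Tendsto Prod.fst (inProbability μ l) l := fun s hs =>
  tendsto_nhds_of_eventually_eq <| (show ∀ᶠ i in l, i ∈ s from hs).mono fun i hi => by simp [hi]

lemma tendsto_inProbability_iff_tendstoInMeasure {E : Type*} [PseudoEMetricSpace E]
    {f : ι → Ω → E} {c : E} :
    Tendsto (fun q : ι × Ω => f q.1 q.2) (inProbability μ l) (𝓝 c) ↔
      TendstoInMeasure μ f l fun _ => c := by
  simp only [Metric.nhds_basis_eball.tendsto_right_iff, eventually_inProbability,
    Metric.mem_eball, not_lt, TendstoInMeasure]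

lemma tendstoInMeasure_pi_iff {κ : Type*} [Fintype κ] {E : κ → Type*}
    [∀ k, PseudoEMetricSpace (E k)] {f : ι → Ω → ∀ k, E k} {c : ∀ k, E k} :
    (TendstoInMeasure μ f l fun _ => c) ↔
      ∀ k, TendstoInMeasure μ (fun i ω => f i ω k) l fun _ => c k := by
  simp only [← tendsto_inProbability_iff_tendstoInMeasure, tendsto_pi_nhds]

lemma tendsto_measure_one_of_eventually_inProbability [IsProbabilityMeasure μ] {P : ι → Ω → Prop}
    (h : ∀ᶠ q in inProbability μ l, P q.1 q.2) : Tendsto (fun i => μ {ω | P i ω}) l (𝓝 1) := by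
  have hlower : Tendsto (fun i => 1 - μ {ω | ¬ P i ω}) l (𝓝 1) := by
    simpa using ENNReal.Tendsto.sub tendsto_const_nhds (eventually_inProbability.mp h)
      (.inl ENNReal.one_ne_top)
  refine tendsto_of_tendsto_of_tendsto_of_le_of_le hlower tendsto_const_nhds (fun i => ?_)
    fun i => prob_le_one
  rw [tsub_le_iff_right, ← measure_univ (μ := μ), ← Set.union_compl_self {ω | P i ω}]
  exact measure_union_le _ _

end ConvergenceInProbability

section Slutsky

variable {ι Ω Ω' E : Type*} [MeasurableSpace Ω] {μ : Measure Ω} [IsProbabilityMeasure μ]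
  [MeasurableSpace Ω'] {μ' : Measure Ω'} [IsProbabilityMeasure μ'] {l : Filter ι}
  [SeminormedAddCommGroup E] [MeasurableSpace E] [BorelSpace E]

lemma tendstoInMeasure_zero_of_tendstoInDistribution {Z : ι → Ω → E}
    (hZ : TendstoInDistribution Z l (fun _ : Ω' => 0) (fun _ => μ) μ') :
    TendstoInMeasure μ Z l fun _ => 0 := by
  rw [tendstoInMeasure_iff_norm]
  intro δ hδ
  have hclosed : IsClosed {x : E | δ ≤ ‖x‖} := isClosed_le continuous_const continuous_norm
  have hlimsup := ProbabilityMeasure.limsup_measure_closed_le_of_tendsto hZ.tendsto hclosed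
  simp only [ProbabilityMeasure.coe_mk, Measure.map_const, measure_univ, one_smul,
    Measure.map_apply_of_aemeasurable (hZ.forall_aemeasurable _) hclosed.measurableSet] at hlimsup
  rw [Measure.dirac_apply' _ hclosed.measurableSet, Set.indicator_of_notMem (by simpa using hδ)]
    at hlimsup
  simpa using tendsto_of_le_liminf_of_limsup_le zero_le hlimsup

lemma tendstoInMeasure_smul_of_tendstoInDistribution [NormedSpace ℝ E] [SecondCountableTopology E]
    [l.IsCountablyGenerated] {a : ι → ℝ} (ha : Tendsto a l (𝓝 0)) {Z : ι → Ω → E} {Z' : Ω' → E}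
    (hZ : TendstoInDistribution Z l Z' (fun _ => μ) μ') :
    TendstoInMeasure μ (fun i ω => a i • Z i ω) l fun _ => 0 := by
  have ha' : TendstoInMeasure μ (fun i _ => a i) l fun _ => 0 :=
    tendsto_inProbability_iff_tendstoInMeasure.mp (ha.comp tendsto_fst_inProbability)
  have hslutsky := hZ.continuous_comp_prodMk_of_tendstoInMeasure_const
    (g := fun q : E × ℝ => q.2 • q.1) (by fun_prop) ha' (by fun_prop)
  simp only [zero_smul] at hslutsky
  exact tendstoInMeasure_zero_of_tendstoInDistribution hslutsky

lemma tendstoInMeasure_smul_sub_of_tendstoInDistribution [NormedSpace ℝ E]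
    [SecondCountableTopology E] [l.IsCountablyGenerated] {a c : ι → ℝ} (ha : ∀ᶠ i in l, a i ≠ 0)
    (hca : Tendsto (fun i => c i / a i) l (𝓝 0)) {B : ι → Ω → E} {β : E} {Z' : Ω' → E}
    (hB : TendstoInDistribution (fun i ω => a i • (B i ω - β)) l Z' (fun _ => μ) μ') :
    TendstoInMeasure μ (fun i ω => c i • (B i ω - β)) l fun _ => 0 := by
  refine (tendstoInMeasure_smul_of_tendstoInDistribution hca hB).congr' ?_ .rfl
  filter_upwards [ha] with i hi
  exact .of_forall fun ω => by simp only [smul_smul, div_mul_cancel₀ _ hi]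

end Slutsky

section Noise

variable {ι κ Ω : Type*} [MeasurableSpace Ω] {μ : Measure Ω}

lemma tendstoInMeasure_zero_of_tendsto_variance [IsFiniteMeasure μ] {l : Filter ι}
    {Z : ι → Ω → ℝ} (hZ : ∀ i, MemLp (Z i) 2 μ) (hmean : ∀ i, μ[Z i] = 0)
    (hvar : Tendsto (fun i => Var[Z i; μ]) l (𝓝 0)) : TendstoInMeasure μ Z l fun _ => 0 := by
  rw [tendstoInMeasure_iff_norm]
  intro δ hδ
  have hbound : Tendsto (fun i => ENNReal.ofReal (Var[Z i; μ] / δ ^ 2)) l (𝓝 0) := by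
    simpa using ENNReal.tendsto_ofReal (hvar.div_const (δ ^ 2))
  refine tendsto_of_tendsto_of_tendsto_of_le_of_le tendsto_const_nhds hbound (fun _ => zero_le)
    fun i => ?_
  simpa [hmean] using meas_ge_le_variance_div_sq (hZ i) hδ

lemma memLp_two_of_hasLaw_gaussianReal {f : Ω → ℝ} {m : ℝ} {v : ℝ≥0}
    (hf : HasLaw f (gaussianReal m v) μ) : MemLp f 2 μ := by
  have hid : MemLp id 2 (μ.map f) := hf.map_eq ▸ memLp_id_gaussianReal 2
  exact (memLp_map_measure_iff hid.1 hf.aemeasurable).mp hid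

variable [Fintype κ] [IsFiniteMeasure μ] {f : κ → Ω → ℝ}

lemma variance_sum_const_mul_of_uncorrelated (a : κ → ℝ) (hf : ∀ k, MemLp (f k) 2 μ)
    (hcov : Pairwise fun j k => cov[f j, f k; μ] = 0) :
    Var[fun ω => ∑ k, a k * f k ω; μ] = ∑ k, a k ^ 2 * Var[f k; μ] := by
  rw [variance_fun_sum fun k => (hf k).const_mul (a k)]
  refine Finset.sum_congr rfl fun k _ => ?_
  simp only [covariance_const_mul_left, covariance_const_mul_right]
  rw [Finset.sum_eq_single k (fun j _ hj => by simp [hcov hj.symm]) (by simp),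
    covariance_self (hf k).aemeasurable]
  ring

lemma variance_transpose_mulVec_apply_le {κ' : Type*} (X : Matrix κ κ' ℝ) {v : ℝ}
    (hf : ∀ k, MemLp (f k) 2 μ) (hvar : ∀ k, Var[f k; μ] ≤ v)
    (hcov : Pairwise fun j k => cov[f j, f k; μ] = 0) (j : κ') :
    Var[fun ω => (Xᵀ *ᵥ fun k => f k ω) j; μ] ≤ (Xᵀ * X) j j * v := by
  simp only [Matrix.mulVec, dotProduct, Matrix.mul_apply, Finset.sum_mul, Matrix.transpose_apply]
  rw [variance_sum_const_mul_of_uncorrelated _ hf hcov]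
  simp only [← sq]
  gcongr with k
  exact hvar k

lemma tendstoInMeasure_inv_smul_transpose_mulVec {p : ℕ}
    {X : (n : ℕ) → Matrix (Fin n) (Fin p) ℝ} {C : Matrix (Fin p) (Fin p) ℝ}
    (hX : Tendsto (fun n : ℕ => (1 / n : ℝ) • ((X n)ᵀ * X n)) atTop (𝓝 C))
    {ε : (n : ℕ) → Fin n → Ω → ℝ} {v : ℝ} (hε : ∀ n i, MemLp (ε n i) 2 μ)
    (hmean : ∀ n i, μ[ε n i] = 0) (hvar : ∀ n i, Var[ε n i; μ] ≤ v)
    (hcov : ∀ n, Pairwise fun i k => cov[ε n i, ε n k; μ] = 0)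
    {eta : ℕ → ℝ} (heta : Tendsto (fun n : ℕ => eta n / √n) atTop atTop) :
    TendstoInMeasure μ (fun n ω => (eta n)⁻¹ • ((X n)ᵀ *ᵥ fun i => ε n i ω)) atTop fun _ => 0 := by
  refine tendstoInMeasure_pi_iff.mpr fun j => ?_
  simp only [Pi.smul_apply, smul_eq_mul, Pi.zero_apply]
  have hterm (n : ℕ) (i : Fin n) : MemLp (fun ω => (X n)ᵀ j i * ε n i ω) 2 μ :=
    (hε n i).const_mul _
  have hscore (n : ℕ) : MemLp (fun ω => ((X n)ᵀ *ᵥ fun i => ε n i ω) j) 2 μ :=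
    memLp_finsetSum Finset.univ fun i _ => hterm n i
  refine tendstoInMeasure_zero_of_tendsto_variance (fun n => (hscore n).const_mul _)
    (fun n => ?_) ?_
  · simp only [Matrix.mulVec, dotProduct]
    rw [integral_const_mul, integral_finsetSum _ fun i _ => (hterm n i).integrable one_le_two]
    simp [integral_const_mul, hmean]
  have hdiag : Tendsto (fun n : ℕ => ((1 / n : ℝ) • ((X n)ᵀ * X n)) j j) atTop (𝓝 (C j j)) :=
    tendsto_pi_nhds.mp (tendsto_pi_nhds.mp hX j) j
  have hbound : Tendsto (fun n : ℕ => (eta n / √n)⁻¹ ^ 2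
      * (((1 / n : ℝ) • ((X n)ᵀ * X n)) j j * v)) atTop (𝓝 0) := by
    simpa using (heta.inv_tendsto_atTop.pow 2).mul (hdiag.mul_const v)
  refine squeeze_zero' (.of_forall fun n => variance_nonneg _ _) ?_ hbound
  filter_upwards [eventually_gt_atTop 0] with n hn
  have hn_pos : (0 : ℝ) < n := by exact_mod_cast hn
  calc Var[fun ω => (eta n)⁻¹ * ((X n)ᵀ *ᵥ fun i => ε n i ω) j; μ]
      ≤ (eta n)⁻¹ ^ 2 * (((X n)ᵀ * X n) j j * v) := by
        rw [variance_const_mul]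
        gcongr
        exact variance_transpose_mulVec_apply_le (X n) (hε n) (hvar n) (hcov n) j
    _ = (eta n / √n)⁻¹ ^ 2 * (((1 / n : ℝ) • ((X n)ᵀ * X n)) j j * v) := by
        rw [Matrix.smul_apply, smul_eq_mul, inv_div, div_pow, Real.sq_sqrt hn_pos.le]
        field_simp

end Noise

section Consistency

variable {ι Ω : Type*} [MeasurableSpace Ω] {μ : Measure Ω} [IsProbabilityMeasure μ] {l : Filter ι}

theorem tendsto_measure_forall_estimate_eq {p : ℕ} {N : ι → ℕ} (hN : ∀ᶠ i in l, N i ≠ 0)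
    {X : ∀ i, Matrix (Fin (N i)) (Fin p) ℝ} {C : Matrix (Fin p) (Fin p) ℝ} (hC : C.PosDef)
    (hX : Tendsto (fun i => (1 / N i : ℝ) • ((X i)ᵀ * X i)) l (𝓝 C))
    {lam eta : ι → ℝ} (hlam : ∀ᶠ i in l, 0 ≤ lam i) (heta : ∀ᶠ i in l, 0 < eta i)
    (hlam_eta : Tendsto (fun i => lam i / eta i) l (𝓝 0)) {γ₁ γ₂ : ℝ} (hγ₂ : 0 ≤ γ₂)
    {e : ∀ i, Ω → Fin (N i) → ℝ} {β : Fin p → ℝ} {bt b : ι → Ω → Fin p → ℝ}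
    (hscore : TendstoInMeasure μ (fun i ω => (eta i)⁻¹ • ((X i)ᵀ *ᵥ e i ω)) l fun _ => 0)
    (hbt : TendstoInMeasure μ bt l fun _ => β)
    (hrate : TendstoInMeasure μ (fun i ω => (N i / eta i) • (bt i ω - β)) l fun _ => 0)
    (hb : ∀ i ω,
      IsEstimate (X i) (X i *ᵥ β + e i ω) (lam i) (eta i) γ₁ γ₂ (bt i ω) (b i ω)) :
    Tendsto (fun i => μ {ω | ∀ j, β j ≠ 0 → b i ω j = bt i ω j}) l (𝓝 1) := by
  have hfst : Tendsto Prod.fst (inProbability μ l) l := tendsto_fst_inProbability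
  simp only [← tendsto_inProbability_iff_tendstoInMeasure] at hscore hbt hrate
  exact tendsto_measure_one_of_eventually_inProbability <|
    eventually_forall_estimate_eq (hfst.eventually hN) hC (hX.comp hfst) (hfst.eventually hlam)
      (hfst.eventually heta) hγ₂ (hlam_eta.comp hfst) hscore hbt hrate
      (.of_forall fun q => hb q.1 q.2)

end Consistency

section Regimes

variable {m : ℕ → ℕ} {lam eta : ℕ → ℝ} {γ₁ γ₂ : ℝ}

lemma eventually_one_le_rpow (hm : ∀ᶠ n in atTop, 0 < m n) {γ : ℝ} (hγ : 0 ≤ γ) :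
    ∀ᶠ n in atTop, 1 ≤ (m n : ℝ) ^ γ :=
  hm.mono fun _ hn => Real.one_le_rpow (by exact_mod_cast hn) hγ

lemma RegimeI.tendsto_eta_div_sqrt (h : RegimeI m lam eta γ₁ γ₂) (hm : ∀ᶠ n in atTop, 0 < m n)
    (heta : ∀ n, 0 ≤ eta n) (hγ₂ : 0 ≤ γ₂) :
    Tendsto (fun n : ℕ => eta n / √n) atTop atTop := by
  refine tendsto_atTop_mono' _ ?_ h.1
  filter_upwards [eventually_one_le_rpow hm hγ₂, eventually_gt_atTop 0] with n hpow hn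
  have hn_pos : (0 : ℝ) < n := by exact_mod_cast hn
  have := heta n
  gcongr
  exact le_mul_of_one_le_right hn_pos.le hpow

lemma RegimeI.tendsto_lam_div_eta (h : RegimeI m lam eta γ₁ γ₂) (hm : ∀ᶠ n in atTop, 0 < m n)
    (hlam : ∀ n, 0 ≤ lam n) (heta : ∀ n, 0 ≤ eta n) (hγ : 0 ≤ γ₁ + γ₂) :
    Tendsto (fun n => lam n / eta n) atTop (𝓝 0) := by
  refine squeeze_zero' (.of_forall fun n => div_nonneg (hlam n) (heta n)) ?_ h.2
  filter_upwards [eventually_one_le_rpow hm hγ] with n hpow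
  have := heta n
  gcongr
  exact le_mul_of_one_le_left (hlam n) (Real.one_le_sqrt.mpr hpow)

lemma RegimeII.tendsto_lam_div_eta (h : RegimeII m lam eta γ₁ γ₂) :
    Tendsto (fun n => lam n / eta n) atTop (𝓝 0) := by
  simpa only [Pi.inv_def, inv_div] using h.2.2.1.inv_tendsto_atTop

lemma RegimeIV.tendsto_lam_div_eta (h : RegimeIV m lam eta γ₁ γ₂) (hm : ∀ᶠ n in atTop, 0 < m n)
    (hlam : ∀ n, 0 ≤ lam n) (heta : ∀ n, 0 ≤ eta n) (hγ₁ : 0 ≤ γ₁) :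
    Tendsto (fun n => lam n / eta n) atTop (𝓝 0) := by
  obtain ⟨⟨_, -, hlam_lim⟩, heta_lim, -⟩ := h
  refine squeeze_zero' (.of_forall fun n => div_nonneg (hlam n) (heta n)) ?_
    (hlam_lim.div_atTop heta_lim)
  filter_upwards [eventually_one_le_rpow hm hγ₁, eventually_gt_atTop 0] with n hpow hn
  have : 0 < √(n : ℝ) := Real.sqrt_pos.mpr (by exact_mod_cast hn)
  have := hlam n
  have := heta n
  calc lam n / eta n = 1 / √n * lam n / (eta n / √n) := by field_simp
    _ ≤ √((m n : ℝ) ^ γ₁ / n) * lam n / (eta n / √n) := by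
      rw [Real.sqrt_div (by positivity)]
      gcongr
      exact Real.one_le_sqrt.mpr hpow

lemma tendsto_eta_div_sqrt_and_lam_div_eta (hm : ∀ᶠ n in atTop, 0 < m n)
    (hlam : ∀ n, 0 ≤ lam n) (heta : ∀ n, 0 ≤ eta n) (hγ₁ : 0 ≤ γ₁) (hγ₂ : 0 ≤ γ₂)
    (h : RegimeI m lam eta γ₁ γ₂ ∨ RegimeII m lam eta γ₁ γ₂ ∨ RegimeIV m lam eta γ₁ γ₂) :
    Tendsto (fun n : ℕ => eta n / √n) atTop atTop ∧
      Tendsto (fun n => lam n / eta n) atTop (𝓝 0) := by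
  rcases h with h | h | h
  · exact ⟨h.tendsto_eta_div_sqrt hm heta hγ₂,
      h.tendsto_lam_div_eta hm hlam heta (add_nonneg hγ₁ hγ₂)⟩
  · exact ⟨h.2.1, h.tendsto_lam_div_eta⟩
  · exact ⟨h.2.1, h.tendsto_lam_div_eta hm hlam heta hγ₁⟩

lemma tendsto_one_div_sqrt_of_tendsto_div {r : ℝ}
    (hmn : Tendsto (fun n : ℕ => (n : ℝ) / m n) atTop (𝓝 r)) :
    Tendsto (fun n => 1 / √(m n : ℝ)) atTop (𝓝 0) := by
  refine (hmn.sqrt.div_atTop (Real.tendsto_sqrt_atTop.comp tendsto_natCast_atTop_atTop)).congr' ?_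
  filter_upwards [eventually_gt_atTop 0] with n hn
  have : 0 < √(n : ℝ) := Real.sqrt_pos.mpr (by exact_mod_cast hn)
  rw [Real.sqrt_div n.cast_nonneg, Function.comp_apply]
  field_simp

lemma tendsto_div_div_sqrt_of_tendsto_div {r : ℝ}
    (hmn : Tendsto (fun n : ℕ => (n : ℝ) / m n) atTop (𝓝 r))
    (heta : Tendsto (fun n : ℕ => eta n / √n) atTop atTop) :
    Tendsto (fun n : ℕ => n / eta n / √(m n : ℝ)) atTop (𝓝 0) := by
  refine (hmn.sqrt.div_atTop heta).congr fun n => ?_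
  nth_rw 3 [← Real.mul_self_sqrt n.cast_nonneg]
  rw [Real.sqrt_div n.cast_nonneg, div_div_eq_mul_div]
  ring

end Regimes

end AdaptiveTransferLasso

open AdaptiveTransferLasso

theorem mainTheorem4_general
    {Ω : Type*} [MeasurableSpace Ω] (μ : Measure Ω) [IsProbabilityMeasure μ]
    {p : ℕ} (βstar : Fin p → ℝ)
    (X : (n : ℕ) → Matrix (Fin n) (Fin p) ℝ) (C : Matrix (Fin p) (Fin p) ℝ) (hC : C.PosDef)
    (hX : Tendsto (fun n : ℕ => (1 / n : ℝ) • ((X n)ᵀ * X n)) atTop (𝓝 C))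
    (v : ℝ) (ε : (n : ℕ) → Fin n → Ω → ℝ) (hε : ∀ n i, MemLp (ε n i) 2 μ)
    (hmean : ∀ n i, μ[ε n i] = 0) (hvar : ∀ n i, Var[ε n i; μ] ≤ v)
    (hcov : ∀ n, Pairwise fun i k => cov[ε n i, ε n k; μ] = 0)
    (m : ℕ → ℕ) (hm : ∀ᶠ n in atTop, 0 < m n)
    (r₀ : ℝ) (hmn : Tendsto (fun n : ℕ => (n : ℝ) / m n) atTop (𝓝 r₀))
    (βtilde : ℕ → Ω → Fin p → ℝ)
    (ν : Measure (Fin p → ℝ)) [IsProbabilityMeasure ν]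
    (hz : TendstoInDistribution (fun (n : ℕ) ω => √(m n : ℝ) • (βtilde n ω - βstar)) atTop
      (id : (Fin p → ℝ) → Fin p → ℝ) (fun _ => μ) ν)
    (γ₁ γ₂ : ℝ) (hγ₂ : 0 ≤ γ₂)
    (lam eta : ℕ → ℝ) (hlam : ∀ n, 0 ≤ lam n)
    (heta : Tendsto (fun n : ℕ => eta n / √n) atTop atTop)
    (hlam_eta : Tendsto (fun n => lam n / eta n) atTop (𝓝 0))
    (βhat : ℕ → Ω → Fin p → ℝ)
    (hβhat : ∀ n ω, IsEstimate (X n) (fun i => (X n *ᵥ βstar) i + ε n i ω)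
      (lam n) (eta n) γ₁ γ₂ (βtilde n ω) (βhat n ω)) :
    Tendsto (fun n => μ {ω | ∀ j, βstar j ≠ 0 → βhat n ω j = βtilde n ω j}) atTop (𝓝 1) := by
  have hsqrt_m : ∀ᶠ n in atTop, √(m n : ℝ) ≠ 0 := hm.mono fun n hn => by positivity
  have heta_pos : ∀ᶠ n in atTop, 0 < eta n := (heta.eventually_gt_atTop 0).mono fun n hn =>
    lt_of_not_ge fun h => hn.not_ge (div_nonpos_of_nonpos_of_nonneg h (Real.sqrt_nonneg _))
  have hscore := tendstoInMeasure_inv_smul_transpose_mulVec hX hε hmean hvar hcov heta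
  have hconsistent : TendstoInMeasure μ βtilde atTop fun _ => βstar := by
    simpa [tendstoInMeasure_iff_norm] using tendstoInMeasure_smul_sub_of_tendstoInDistribution
      hsqrt_m (tendsto_one_div_sqrt_of_tendsto_div hmn) hz
  have hrate := tendstoInMeasure_smul_sub_of_tendstoInDistribution hsqrt_m
    (tendsto_div_div_sqrt_of_tendsto_div hmn heta) hz
  exact tendsto_measure_forall_estimate_eq (eventually_ne_atTop 0) hC hX (.of_forall hlam) heta_pos
    hlam_eta hγ₂ hscore hconsistent hrate hβhat

theorem mainTheorem4
    {Ω : Type*} [MeasurableSpace Ω] (μ : Measure Ω) [IsProbabilityMeasure μ]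
    {p : ℕ} (βstar : Fin p → ℝ)
    -- fixed design, `C_n = XᵀX / n → C ≻ O` and `max_i ‖x_i‖₂² / n → 0`
    (X : (n : ℕ) → Matrix (Fin n) (Fin p) ℝ) (C : Matrix (Fin p) (Fin p) ℝ) (hC : C.PosDef)
    (hX : Tendsto (fun n : ℕ => (1 / n : ℝ) • ((X n)ᵀ * X n)) atTop (𝓝 C))
    (hXmax : Tendsto (fun n : ℕ => (1 / n : ℝ) * ⨆ i, ∑ j, X n i j ^ 2) atTop (𝓝 0))
    -- i.i.d. Gaussian noise
    (σ : ℝ≥0) (ε : (n : ℕ) → Fin n → Ω → ℝ)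
    (hεlaw : ∀ n i, HasLaw (ε n i) (gaussianReal 0 (σ ^ 2)) μ)
    (hεindep : ∀ n, iIndepFun (ε n) μ)
    -- source sample size
    (m : ℕ → ℕ) (hm : ∀ᶠ n in atTop, 0 < m n)
    (r₀ : ℝ) (hr₀ : 0 ≤ r₀) (hmn : Tendsto (fun n : ℕ => (n : ℝ) / m n) atTop (𝓝 r₀))
    -- initial estimator: `√m (βtilde - βstar)` converges in distribution to some law `ν`,
    -- and the source data are independent of the target data
    (βtilde : ℕ → Ω → Fin p → ℝ)
    (ν : Measure (Fin p → ℝ)) [IsProbabilityMeasure ν]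
    (hz : TendstoInDistribution (fun (n : ℕ) ω => √(m n : ℝ) • (βtilde n ω - βstar)) atTop
      (id : (Fin p → ℝ) → Fin p → ℝ) (fun _ => μ) ν)
    (hindep : ∀ n, IndepFun (βtilde n) (fun ω i => ε n i ω) μ)
    -- hyperparameters
    (γ₁ γ₂ : ℝ) (hγ₁ : 0 ≤ γ₁) (hγ₂ : 0 ≤ γ₂)
    (lam eta : ℕ → ℝ) (hlam : ∀ n, 0 ≤ lam n) (heta : ∀ n, 0 ≤ eta n)
    (hregime : AdaptiveTransferLasso.RegimeI m lam eta γ₁ γ₂ ∨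
      AdaptiveTransferLasso.RegimeII m lam eta γ₁ γ₂ ∨
      AdaptiveTransferLasso.RegimeIV m lam eta γ₁ γ₂)
    -- the Adaptive Transfer Lasso estimator for the responses `y = X βstar + ε`
    (βhat : ℕ → Ω → Fin p → ℝ)
    (hβhat : ∀ n ω, AdaptiveTransferLasso.IsEstimate (X n)
      (fun i => (X n *ᵥ βstar) i + ε n i ω) (lam n) (eta n) γ₁ γ₂ (βtilde n ω) (βhat n ω)) :
    Tendsto (fun n => μ {ω | ∀ j, βstar j ≠ 0 → βhat n ω j = βtilde n ω j}) atTop (𝓝 1) := by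
  obtain ⟨heta_rate, hlam_eta⟩ :=
    tendsto_eta_div_sqrt_and_lam_div_eta hm hlam heta hγ₁ hγ₂ hregime
  have hε (n : ℕ) (i : Fin n) : MemLp (ε n i) 2 μ := memLp_two_of_hasLaw_gaussianReal (hεlaw n i)
  exact mainTheorem4_general μ βstar X C hC hX (σ ^ 2 : ℝ≥0) ε hε
    (fun n i => (hεlaw n i).integral_eq.trans integral_id_gaussianReal)
    (fun n i => ((hεlaw n i).variance_eq.trans variance_id_gaussianReal).le)
    (fun n i k hik => ((hεindep n).indepFun hik).covariance_eq_zero (hε n i) (hε n k))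
    m hm r₀ hmn βtilde ν hz γ₁ γ₂ hγ₂ lam eta hlam heta_rate hlam_eta βhat hβhat
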